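/- Diffeological preliminaries. All quotients, products and subsets of diffeological spaces carry the quotient, product and sub-diffeology. The $D$-topology of a diffeological space $X$ consists of the sets whose preimage under every plot is open. Local finiteness, open covers and closures are taken in the $D$-topology. For $f:X\to\mathbb{R}$, $\operatorname{supp}(f)$ is the closure of $f^{-1}((0,\infty))$. A family of smooth functions $\mu_i:X\to\mathbb{R}$ is a smooth partition of unity if $\mu_i\ge 0$, $\{\operatorname{supp}(\mu_i)\}$ is locally finite and $\sum_i\mu_i=1$. It is subordinate to $\{X_i\}$ if $\operatorname{supp}(\mu_i)\subseteq X_i$ for all $i$. Bundles. Let $G$ be a diffeological group and $\pi:E\to B$ a smooth map of diffeological spaces, where $G$ acts smoothly on $E$ from the right and $\pi(x\cdot g)=\pi(x)$. Then $\pi$ is a trivial principal $G$-bundle if there is a $G$-equivariant diffeomorphism $E\cong B\times G$ over $B$, with $(b,g)\cdot g'=(b,gg')$. It is locally trivial if $B$ has a $D$-open cover by sets $U$ such that each restriction $\pi^{-1}(U)\to U$ is trivial. It is a principal $G$-bundle if its pullback along every plot $U\to B$ ($U$ open in some $\mathbb{R}^n$) is locally trivial. A principal $G$-bundle is $D$-numerable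 if there is a smooth partition of unity subordinate to a $D$-open cover $\{B_i\}$ of $B$ with each $\pi|_{B_i}:\pi^{-1}(B_i)\to B_i$ a trivial principal $G$-bundle. The spaces. Let $$\Delta^\omega=\Big\{(t_i)\in\bigoplus_{i\in\mathbb{N}}\mathbb{R} : t_i\ge 0,\ \sum_i t_i=1\Big\}$$ with the sub-diffeology of $\bigoplus_{\mathbb N}\mathbb{R}$, whose plots are the maps that have smooth components and locally have only finitely many components not identically zero. Let $EG$ be the quotient of $\Delta^\omega\times\prod_{\mathbb{N}}G$ by the relation $(t_i,g_i)\sim(t_i',g_i')$ iff $t_i=t_i'$ for all $i$, and $g_i=g_i'$ whenever $t_i\ne 0$. The group $G$ acts on $EG$ from the right by $[t_i,g_i]\cdot g=[t_i,g_ig]$. Let $BG=EG/G$ and let $\pi:EG\to BG$ be the quotient map. **Theorem.** For every diffeological group $G$, the map $\pi:EG\to BG$ is a $D$-numerable principal $G$-bundle. More precisely: 1. $\pi$ is a principal $G$-bundle, and it is $D$-numerable. 2. The sets $B_i=\{[t_j,g_j]\in BG : t_i>1/2^{i+2}\}$, $i\in\mathbb{N}=\{0,1,2,\dots\}$, form a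 locally finite $D$-open cover of $BG$, and each $\pi|_{B_i}:\pi^{-1}(B_i)\to B_i$ is a trivial principal $G$-bundle. 3. Let $\rho:\mathbb{R}\to\mathbb{R}$ be any smooth function that vanishes on $(-\infty,0]$ and is strictly increasing on $(0,\infty)$. Then the functions $$\tau_i([t_j,g_j])=\frac{\rho(t_i-1/2^{i+1})}{\sum_{j=0}^\infty\rho(t_j-1/2^{j+1})},\qquad i\in\mathbb{N},$$ form a smooth partition of unity on $BG$ subordinate to $\{B_i\}_{i\in\mathbb{N}}$. -/

import Mathlib

open Set Topology
open scoped ContDiff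

namespace Diffeology

noncomputable section

/-! ### Constructions of diffeological spaces -/

/-- Near each point of an open set `u`, the identity agrees with a smooth map into `u`. -/
theorem exists_contDiff_mapsTo_eventuallyEq_id {n : ℕ} {u : Set (EuclideanSpace ℝ (Fin n))}
    (hu : IsOpen u) {x : EuclideanSpace ℝ (Fin n)} (hx : x ∈ u) :
    ∃ f : EuclideanSpace ℝ (Fin n) → EuclideanSpace ℝ (Fin n),
      ContDiff ℝ ∞ f ∧ (∀ y, f y ∈ u) ∧ ∀ᶠ y in 𝓝 x, f y = y := by
  obtain ⟨ε, hε, hball⟩ := Metric.isOpen_iff.mp hu x hx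
  let χ : ContDiffBump x := ⟨ε / 3, ε / 2, by positivity, by linarith⟩
  refine ⟨fun y => x + χ y • (y - x), ?_, fun y => hball ?_, ?_⟩
  · exact contDiff_const.add (χ.contDiff.smul (contDiff_id.sub contDiff_const))
  · rw [Metric.mem_ball, dist_eq_norm, add_sub_cancel_left, norm_smul, Real.norm_eq_abs,
      abs_of_nonneg χ.nonneg]
    by_cases hy : ε / 2 ≤ dist y x
    · rw [χ.zero_of_le_dist hy, zero_mul]
      exact hε
    · rw [dist_eq_norm] at hy
      have h1 : χ y ≤ 1 := χ.le_one
      have h0 : 0 ≤ χ y := χ.nonneg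
      nlinarith [norm_nonneg (y - x)]
  · filter_upwards [χ.eventuallyEq_one] with y hy
    simp [hy]

/-- A diffeology from a class of maps `ℝⁿ → X` that contains the constants, is stable under smooth
reparametrisation, and contains every map that agrees near each point with one of its members. -/
@[reducible] def ofGerms {X : Type*} (P : (n : ℕ) → (EuclideanSpace ℝ (Fin n) → X) → Prop)
    (hconst : ∀ n x, P n fun _ => x)
    (hcomp : ∀ n m (p : EuclideanSpace ℝ (Fin m) → X)
      (f : EuclideanSpace ℝ (Fin n) → EuclideanSpace ℝ (Fin m)),
      P m p → ContDiff ℝ ∞ f → P n (p ∘ f))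
    (hloc : ∀ n (p : EuclideanSpace ℝ (Fin n) → X),
      (∀ x, ∃ q, P n q ∧ ∀ᶠ y in 𝓝 x, q y = p y) → P n p) :
    DiffeologicalSpace X where
  plots n := {p | P n p}
  constant_plots x := hconst _ x
  plot_reparam hp hf := hcomp _ _ _ _ hp hf
  locality {n p} h := by
    refine hloc n p fun x => ?_
    obtain ⟨u, hu, hxu, hp⟩ := h x
    obtain ⟨f, hf, hfu, hfx⟩ := exists_contDiff_mapsTo_eventuallyEq_id hu hxu
    refine ⟨p ∘ f, hp hfu hf, ?_⟩
    filter_upwards [hfx] with y hy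
    simp [hy]

/-- The sub-diffeology: a map into `{x // P x}` is a plot iff it is a plot of `X`. -/
instance instSubtype {X : Type*} [DiffeologicalSpace X] (P : X → Prop) :
    DiffeologicalSpace {x // P x} where
  plots _ := {p | IsPlot fun y => (p y : X)}
  constant_plots x := isPlot_const (x := (x : X))
  plot_reparam hp hf := isPlot_reparam hp hf
  locality h := DiffeologicalSpace.locality h

/-- The product diffeology on `X × Y`. -/
instance instProd {X Y : Type*} [DiffeologicalSpace X] [DiffeologicalSpace Y] :
    DiffeologicalSpace (X × Y) where
  plots _ := {p | IsPlot (fun y => (p y).1) ∧ IsPlot fun y => (p y).2}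
  constant_plots x := ⟨isPlot_const (x := x.1), isPlot_const (x := x.2)⟩
  plot_reparam hp hf := ⟨isPlot_reparam hp.1 hf, isPlot_reparam hp.2 hf⟩
  locality h := by
    constructor <;> refine DiffeologicalSpace.locality fun x => ?_
    · obtain ⟨u, hu, hxu, h'⟩ := h x
      exact ⟨u, hu, hxu, fun hfu hf => (h' hfu hf).1⟩
    · obtain ⟨u, hu, hxu, h'⟩ := h x
      exact ⟨u, hu, hxu, fun hfu hf => (h' hfu hf).2⟩

/-- The product diffeology on `∏ i, X i`. -/
instance instPi {ι : Type*} {X : ι → Type*} [∀ i, DiffeologicalSpace (X i)] :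
    DiffeologicalSpace (∀ i, X i) where
  plots _ := {p | ∀ i, IsPlot fun y => p y i}
  constant_plots x := fun i => isPlot_const (x := x i)
  plot_reparam hp hf := fun i => isPlot_reparam (hp i) hf
  locality h := by
    refine fun i => DiffeologicalSpace.locality fun x => ?_
    obtain ⟨u, hu, hxu, h'⟩ := h x
    exact ⟨u, hu, hxu, fun hfu hf => h' hfu hf i⟩

/-- The quotient diffeology: a map into `X / ∼` is a plot iff it lifts, near each point of its
domain, to a plot of `X`.  (A lift defined only on a neighbourhood of `x` can be replaced by a
global one with the same germ at `x`, by `exists_contDiff_mapsTo_eventuallyEq_id`.) -/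
instance instQuotient {X : Type*} [DiffeologicalSpace X] {s : Setoid X} :
    DiffeologicalSpace (Quotient s) :=
  ofGerms (fun n p => ∀ x, ∃ q : EuclideanSpace ℝ (Fin n) → X,
      IsPlot q ∧ ∀ᶠ y in 𝓝 x, Quotient.mk s (q y) = p y)
    (fun _ a _ => ⟨fun _ => a.out, isPlot_const, by simp⟩)
    (fun n m p f hp hf x => by
      obtain ⟨q, hq, hqx⟩ := hp (f x)
      exact ⟨q ∘ f, isPlot_reparam hq hf, hf.continuous.continuousAt.eventually hqx⟩)
    (fun n p h x => by
      obtain ⟨p', hp', hx⟩ := h x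
      obtain ⟨q, hq, hqx⟩ := hp' x
      refine ⟨q, hq, ?_⟩
      filter_upwards [hx, hqx] with y h1 h2
      rw [h2, h1])

/-- The diffeology of `⊕_ω ℝ`, the coproduct of countably many copies of `ℝ` in diffeological
vector spaces: plots are the maps all of whose components are smooth and which locally have only
finitely many components that are not identically zero. -/
instance instFinsupp : DiffeologicalSpace (ℕ →₀ ℝ) :=
  ofGerms (fun n p => (∀ i, ContDiff ℝ ∞ fun x => p x i) ∧
      ∀ x : EuclideanSpace ℝ (Fin n), ∃ N : ℕ, ∀ᶠ y in 𝓝 x, ∀ i > N, p y i = 0)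
    (fun n a => by
      refine ⟨fun i => contDiff_const, fun _ => ⟨a.support.sup id, .of_forall fun _ i hi => ?_⟩⟩
      by_contra h
      exact absurd (Finset.le_sup (f := id) (Finsupp.mem_support_iff.mpr h)) (not_le.mpr hi))
    (fun n m p f hp hf => by
      refine ⟨fun i => (hp.1 i).comp hf, fun x => ?_⟩
      obtain ⟨N, hN⟩ := hp.2 (f x)
      exact ⟨N, hf.continuous.continuousAt.eventually hN⟩)
    (fun n p h => by
      refine ⟨fun i => contDiff_iff_contDiffAt.mpr fun x => ?_, fun x => ?_⟩
      · obtain ⟨q, hq, hx⟩ := h x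
        refine ((hq.1 i).contDiffAt (x := x)).congr_of_eventuallyEq ?_
        filter_upwards [hx] with y hy
        rw [hy]
      · obtain ⟨q, hq, hx⟩ := h x
        obtain ⟨N, hN⟩ := hq.2 x
        refine ⟨N, ?_⟩
        filter_upwards [hx, hN] with y hy h0
        rwa [← hy])

/-- A diffeological group. -/
class DiffeologicalGroup (G : Type*) [Group G] [DiffeologicalSpace G] : Prop where
  smooth_mul : DSmooth fun p : G × G => p.1 * p.2
  smooth_inv : DSmooth fun g : G => g⁻¹

/-! ### Smooth partitions of unity -/

/-- The support of `f : X → ℝ`: the closure of `f⁻¹((0, ∞))` in the D-topology. -/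
def dSupport {X : Type*} [DiffeologicalSpace X] (f : X → ℝ) : Set X :=
  closure[dTopology] (f ⁻¹' Ioi 0)

/-- Local finiteness with respect to the D-topology. -/
def DLocallyFinite {X I : Type*} [DiffeologicalSpace X] (U : I → Set X) : Prop :=
  ∀ x, ∃ V : Set X, IsOpen[dTopology] V ∧ x ∈ V ∧ {i | (U i ∩ V).Nonempty}.Finite

structure IsSmoothPartitionOfUnity {X I : Type*} [DiffeologicalSpace X] (μ : I → X → ℝ) :
    Prop where
  smooth : ∀ i, DSmooth (μ i)
  nonneg : ∀ i x, 0 ≤ μ i x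
  locallyFinite : DLocallyFinite fun i => dSupport (μ i)
  sum_eq_one : ∀ x, ∑ᶠ i, μ i x = 1

def IsSubordinate {X I : Type*} [DiffeologicalSpace X] (μ : I → X → ℝ) (U : I → Set X) : Prop :=
  ∀ i, dSupport (μ i) ⊆ U i

/-- `U` is a cover of `X` by D-open subsets. -/
def IsDOpenCover {X I : Type*} [DiffeologicalSpace X] (U : I → Set X) : Prop :=
  (∀ i, IsOpen[dTopology] (U i)) ∧ ⋃ i, U i = univ

/-! ### Principal bundles

Right actions of `G` are actions of `Gᵐᵒᵖ`; thus `x · g` is `MulOpposite.op g • x`. -/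

/-- A map `π : E → B` with `π (x · g) = π x`. -/
structure InvariantMap (G E B : Type*) [Group G] [MulAction Gᵐᵒᵖ E] where
  toFun : E → B
  invariant : ∀ (x : E) (g : G), toFun (MulOpposite.op g • x) = toFun x

namespace InvariantMap

variable {G E B B' : Type*} [Group G] [MulAction Gᵐᵒᵖ E]

/-- The subspace `π⁻¹(U)` of `E`. -/
def Preimage (π : InvariantMap G E B) (U : Set B) : Type _ := {x : E // π.toFun x ∈ U}

instance (π : InvariantMap G E B) (U : Set B) [DiffeologicalSpace E] :
    DiffeologicalSpace (π.Preimage U) :=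
  inferInstanceAs (DiffeologicalSpace {x : E // π.toFun x ∈ U})

instance (π : InvariantMap G E B) (U : Set B) : MulAction Gᵐᵒᵖ (π.Preimage U) where
  smul g x := ⟨g • x.1, by
    have h := π.invariant x.1 g.unop
    rw [MulOpposite.op_unop] at h
    rw [h]
    exact x.2⟩
  one_smul x := Subtype.ext (one_smul Gᵐᵒᵖ x.1)
  mul_smul g h x := Subtype.ext (mul_smul g h x.1)

/-- The restriction `π|_U : π⁻¹(U) → U`. -/
def restrict (π : InvariantMap G E B) (U : Set B) : InvariantMap G (π.Preimage U) U where
  toFun x := ⟨π.toFun x.1, x.2⟩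
  invariant x g := Subtype.ext (π.invariant x.1 g)

/-- The total space `{(b, x) | f b = π x}` of the pullback `f^*(E)`, a subspace of `B' × E`. -/
def Pullback (π : InvariantMap G E B) (f : B' → B) : Type _ :=
  {z : B' × E // f z.1 = π.toFun z.2}

instance (π : InvariantMap G E B) (f : B' → B) [DiffeologicalSpace E] [DiffeologicalSpace B'] :
    DiffeologicalSpace (π.Pullback f) :=
  inferInstanceAs (DiffeologicalSpace {z : B' × E // f z.1 = π.toFun z.2})

instance (π : InvariantMap G E B) (f : B' → B) : MulAction Gᵐᵒᵖ (π.Pullback f) where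
  smul g z := ⟨(z.1.1, g • z.1.2), by
    have h := π.invariant z.1.2 g.unop
    rw [MulOpposite.op_unop] at h
    exact z.2.trans h.symm⟩
  one_smul z := Subtype.ext (Prod.ext rfl (one_smul Gᵐᵒᵖ z.1.2))
  mul_smul g h z := Subtype.ext (Prod.ext rfl (mul_smul g h z.1.2))

/-- The pullback `f^*(E) → B'`. -/
def pullback (π : InvariantMap G E B) (f : B' → B) : InvariantMap G (π.Pullback f) B' where
  toFun z := z.1.1
  invariant _ _ := rfl

variable [DiffeologicalSpace G] [DiffeologicalSpace E] [DiffeologicalSpace B]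

/-- `π` is a trivial principal `G`-bundle: there is a `G`-equivariant diffeomorphism
`h : E → B × G` over `B`, where `(b, g) · g' = (b, g g')`. -/
def IsTrivial (π : InvariantMap G E B) : Prop :=
  ∃ h : E ≃ B × G, DSmooth h ∧ DSmooth h.symm ∧ (∀ x, (h x).1 = π.toFun x) ∧
    ∀ (x : E) (g : G), h (MulOpposite.op g • x) = ((h x).1, (h x).2 * g)

/-- `π` is a locally trivial principal `G`-bundle. -/
def IsLocallyTrivial (π : InvariantMap G E B) : Prop :=
  ∃ 𝒰 : Set (Set B), (∀ U ∈ 𝒰, IsOpen[dTopology] U) ∧ ⋃₀ 𝒰 = univ ∧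
    ∀ U ∈ 𝒰, (π.restrict U).IsTrivial

/-- `π` is a (diffeological) principal `G`-bundle.  A plot of `B` with domain an open set
`U ⊆ ℝⁿ` is a smooth map `U → B`. -/
structure IsPrincipalBundle (π : InvariantMap G E B) : Prop where
  smooth : DSmooth π.toFun
  smooth_action : DSmooth fun z : E × G => MulOpposite.op z.2 • z.1
  locallyTrivial_pullback : ∀ (n : ℕ) (U : Set (EuclideanSpace ℝ (Fin n))), IsOpen U →
    ∀ p : U → B, DSmooth p → (π.pullback p).IsLocallyTrivial

/-- `π` is a D-numerable principal `G`-bundle. -/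
def IsDNumerable (π : InvariantMap G E B) : Prop :=
  π.IsPrincipalBundle ∧ ∃ (I : Type) (U : I → Set B) (μ : I → B → ℝ),
    IsDOpenCover U ∧ IsSmoothPartitionOfUnity μ ∧ IsSubordinate μ U ∧
      ∀ i, (π.restrict (U i)).IsTrivial

end InvariantMap

/-! ### The spaces `EG` and `BG` -/

/-- The infinite simplex `Δ^ω`, a subspace of `⊕_ω ℝ`. -/
def InfSimplex : Type :=
  {t : ℕ →₀ ℝ // (t.sum fun _ a => a) = 1 ∧ ∀ i, 0 ≤ t i}

instance : DiffeologicalSpace InfSimplex :=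
  inferInstanceAs (DiffeologicalSpace {t : ℕ →₀ ℝ // (t.sum fun _ a => a) = 1 ∧ ∀ i, 0 ≤ t i})

/-- `(t, g) ∼ (t', g')` iff `t = t'` and `g i = g' i` whenever `t i ≠ 0`. -/
def EG.setoid (G : Type*) : Setoid (InfSimplex × (ℕ → G)) where
  r a b := (∀ i, a.1.1 i = b.1.1 i) ∧ ∀ i, a.1.1 i ≠ 0 → a.2 i = b.2 i
  iseqv :=
    { refl := fun _ => ⟨fun _ => rfl, fun _ _ => rfl⟩
      symm := fun h => ⟨fun i => (h.1 i).symm, fun i hi => (h.2 i (by rwa [h.1 i])).symm⟩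
      trans := fun h k => ⟨fun i => (h.1 i).trans (k.1 i),
        fun i hi => (h.2 i hi).trans (k.2 i (by rwa [← h.1 i]))⟩ }

def EG (G : Type*) : Type _ := Quotient (EG.setoid G)

instance (G : Type*) [DiffeologicalSpace G] : DiffeologicalSpace (EG G) :=
  inferInstanceAs (DiffeologicalSpace (Quotient (EG.setoid G)))

/-- The right action `[t, (g_i)] · g = [t, (g_i g)]`. -/
instance (G : Type*) [Group G] : MulAction Gᵐᵒᵖ (EG G) where
  smul g := Quotient.map (fun a => (a.1, fun i => a.2 i * g.unop))
    fun _ _ h => ⟨h.1, fun i hi => congrArg (· * g.unop) (h.2 i hi)⟩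
  one_smul x := by
    induction x using Quotient.ind with
    | _ a =>
      exact congrArg (Quotient.mk (EG.setoid G))
        (Prod.ext (x := (a.1, fun i => a.2 i * 1)) (y := a) rfl (funext fun i => mul_one (a.2 i)))
  mul_smul g h x := by
    induction x using Quotient.ind with
    | _ a =>
      exact congrArg (Quotient.mk (EG.setoid G))
        (Prod.ext (y := (a.1, fun i => a.2 i * h.unop * g.unop)) rfl
          (funext fun i => (mul_assoc (a.2 i) h.unop g.unop).symm))

/-- The orbit space `BG = EG / G`. -/
def BG (G : Type*) [Group G] : Type _ := Quotient (MulAction.orbitRel Gᵐᵒᵖ (EG G))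

instance (G : Type*) [Group G] [DiffeologicalSpace G] : DiffeologicalSpace (BG G) :=
  inferInstanceAs (DiffeologicalSpace (Quotient (MulAction.orbitRel Gᵐᵒᵖ (EG G))))

/-- The quotient map `π : EG → BG`. -/
def EG.proj (G : Type*) [Group G] : InvariantMap G (EG G) (BG G) where
  toFun := Quotient.mk (MulAction.orbitRel Gᵐᵒᵖ (EG G))
  invariant _ g := Quotient.sound ⟨MulOpposite.op g, rfl⟩

/-- The function `EG → ℝ`, `[t, g] ↦ t i`. -/
def EG.coord {G : Type*} (i : ℕ) : EG G → ℝ :=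
  Quotient.lift (fun a : InfSimplex × (ℕ → G) => a.1.1 i) fun _ _ h => h.1 i

/-- The function `BG → ℝ`, `[t, g] ↦ t i`. -/
def BG.coord {G : Type*} [Group G] (i : ℕ) : BG G → ℝ :=
  Quotient.lift (EG.coord i) (by
    rintro _ b ⟨g, rfl⟩
    induction b using Quotient.ind with
    | _ a => rfl)

/-- The set `B_i = {[t, g] ∈ BG | t i > 1 / 2 ^ (i + 2)}`. -/
def BG.cover (G : Type*) [Group G] (i : ℕ) : Set (BG G) :=
  {b | 1 / 2 ^ (i + 2) < BG.coord i b}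

/-- The function `τ_i [t, g] = ρ_i (t i) / ∑ j, ρ_j (t j)`, where `ρ_j s = ρ (s - 1 / 2 ^ (j + 1))`.
The sum has finitely many nonzero terms when `ρ` vanishes on `(-∞, 0]`. -/
def BG.tau (G : Type*) [Group G] (ρ : ℝ → ℝ) (i : ℕ) (b : BG G) : ℝ :=
  ρ (BG.coord i b - 1 / 2 ^ (i + 1)) / ∑ᶠ j : ℕ, ρ (BG.coord j b - 1 / 2 ^ (j + 1))

end

end Diffeology

/-! Where `t i ≠ 0` the entry `g i` depends only on the class `[t, g]`, and it is equivariant for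
right multiplication. So over `B_i` the map `x ↦ (π x, g i)` is a trivialisation, with inverse `([t,
g], a) ↦ [t, g j * (g i)⁻¹ * a]` (`EG.isTrivial_restrict`). Every finite partial sum of the series
of `1 / 2 ^ (i + 1)` is below `1`, so a finitely supported `t` of total mass `1` exceeds one of
these bounds (`InfSimplex.exists_lt`). Hence the `B_i` cover `BG`, and the denominator of `τ_i` is
positive.

Plots of `Δ^ω` locally have finitely many nonzero coordinates. This makes the cover locally finite
(`BG.dLocallyFinite_cover`) and the denominator smooth (`BG.dSmooth_tau`). The gap between the
thresholds `1 / 2 ^ (i + 1)` and `1 / 2 ^ (i + 2)` keeps the closed support of `τ_i` inside the open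
set `B_i` (`BG.isSubordinate_tau`). Pulling the trivial cover back along a plot shows that `π` is
principal. -/

namespace Diffeology

/-! ### Generalities -/

/-- A map that agrees near each point with a plot is a plot. -/
theorem isPlot_of_eventuallyEq {X : Type*} [DiffeologicalSpace X] {n : ℕ}
    {p : EuclideanSpace ℝ (Fin n) → X}
    (h : ∀ x, ∃ q : EuclideanSpace ℝ (Fin n) → X, IsPlot q ∧ ∀ᶠ y in 𝓝 x, q y = p y) :
    IsPlot p := by
  refine DiffeologicalSpace.locality fun x => ?_
  obtain ⟨q, hq, hx⟩ := h x
  obtain ⟨u, hu, huo, hxu⟩ := eventually_nhds_iff.mp hx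
  refine ⟨u, huo, hxu, fun {m f} hfu hf => ?_⟩
  have hpq : p ∘ f = q ∘ f := funext fun y => (hu _ (hfu y)).symm
  rw [hpq]
  exact isPlot_reparam hq hf

theorem IsPlot.mul {G : Type*} [Group G] [DiffeologicalSpace G] [DiffeologicalGroup G] {n : ℕ}
    {p q : EuclideanSpace ℝ (Fin n) → G} (hp : IsPlot p) (hq : IsPlot q) :
    IsPlot fun y => p y * q y :=
  DiffeologicalGroup.smooth_mul n (fun y => (p y, q y)) ⟨hp, hq⟩

theorem IsPlot.inv {G : Type*} [Group G] [DiffeologicalSpace G] [DiffeologicalGroup G] {n : ℕ}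
    {p : EuclideanSpace ℝ (Fin n) → G} (hp : IsPlot p) : IsPlot fun y => (p y)⁻¹ :=
  DiffeologicalGroup.smooth_inv n p hp

theorem DSmooth.isOpen_preimage {X Y : Type*} [DiffeologicalSpace X] [DiffeologicalSpace Y]
    {f : X → Y} (hf : DSmooth f) {U : Set Y} (hU : IsOpen[dTopology] U) :
    IsOpen[dTopology] (f ⁻¹' U) :=
  isOpen_iff_preimages_plots.2 fun n p hp => isOpen_iff_preimages_plots.1 hU n _ (hf n p hp)

theorem DSmooth.isOpen_preimage_real {X : Type*} [DiffeologicalSpace X] {f : X → ℝ}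
    (hf : DSmooth f) {U : Set ℝ} (hU : IsOpen U) : IsOpen[dTopology] (f ⁻¹' U) :=
  isOpen_iff_preimages_plots.2 fun n p hp => hU.preimage (hf n p hp).contDiff.continuous

theorem DSmooth.isClosed_preimage_Ici {X : Type*} [DiffeologicalSpace X] {f : X → ℝ}
    (hf : DSmooth f) (c : ℝ) : IsClosed[dTopology] (f ⁻¹' Ici c) := by
  rw [← @isOpen_compl_iff _ _ dTopology, ← preimage_compl, compl_Ici]
  exact hf.isOpen_preimage_real isOpen_Iio

theorem DLocallyFinite.mono {X I : Type*} [DiffeologicalSpace X] {U V : I → Set X}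
    (hV : DLocallyFinite V) (h : ∀ i, U i ⊆ V i) : DLocallyFinite U := fun x => by
  obtain ⟨W, hW, hx, hfin⟩ := hV x
  exact ⟨W, hW, hx, hfin.subset fun i hi => hi.mono (inter_subset_inter_left W (h i))⟩

namespace InvariantMap

variable {G E B B' : Type*} [Group G] [MulAction Gᵐᵒᵖ E] [DiffeologicalSpace G]
  [DiffeologicalSpace E] [DiffeologicalSpace B] [DiffeologicalSpace B']

/-- The pullback of a bundle that is trivial over `V` is trivial over the preimage of `V`. -/
theorem IsTrivial.pullback_restrict {π : InvariantMap G E B} {V : Set B}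
    (hV : (π.restrict V).IsTrivial) {f : B' → B} (hf : DSmooth f) :
    ((π.pullback f).restrict (f ⁻¹' V)).IsTrivial := by
  obtain ⟨h, hs, hs', hπ, hG⟩ := hV
  have key : ∀ z : (π.pullback f).Preimage (f ⁻¹' V), π.toFun z.1.1.2 ∈ V := fun z => by
    rw [← z.1.2]
    exact z.2
  have hfib : ∀ w : ↥(f ⁻¹' V) × G,
      f w.1.1 = π.toFun (h.symm (⟨f w.1.1, w.1.2⟩, w.2)).1 := fun w => by
    have := hπ (h.symm (⟨f w.1.1, w.1.2⟩, w.2))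
    rw [h.apply_symm_apply] at this
    exact congrArg Subtype.val this
  -- The group component is read off from the given trivialisation at the point of `E`; the base
  -- component is the point of `B'`.
  refine ⟨⟨fun z => (⟨z.1.1.1, z.2⟩, (h ⟨z.1.1.2, key z⟩).2),
    fun w => ⟨⟨(w.1.1, (h.symm (⟨f w.1.1, w.1.2⟩, w.2)).1), hfib w⟩, w.1.2⟩, ?_, ?_⟩,
    ?_, ?_, ?_, ?_⟩
  · intro z
    refine Subtype.ext (Subtype.ext (Prod.ext rfl ?_))
    -- The defining equation of the pullback recovers the discarded base component of `h`.
    have e : ((⟨f z.1.1.1, z.2⟩ : V), (h ⟨z.1.1.2, key z⟩).2) = h ⟨z.1.1.2, key z⟩ :=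
      Prod.ext ((Subtype.ext z.1.2 : _ = (π.restrict V).toFun _).trans (hπ _).symm) rfl
    exact congrArg Subtype.val (h.symm_apply_eq.2 e)
  · intro w
    refine Prod.ext rfl ?_
    change (h (h.symm (⟨f w.1.1, w.1.2⟩, w.2))).2 = w.2
    rw [h.apply_symm_apply]
  · intro n p hp
    exact ⟨hp.1, (hs n (fun y => ⟨(p y).1.1.2, key (p y)⟩) hp.2).2⟩
  · intro n p hp
    exact ⟨hp.1, hs' n (fun y => (⟨f (p y).1.1, (p y).1.2⟩, (p y).2)) ⟨hf n _ hp.1, hp.2⟩⟩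
  · intro z
    rfl
  · intro z g
    have e := congrArg Prod.snd (hG ⟨z.1.1.2, key z⟩ g)
    exact Prod.ext rfl e

end InvariantMap

/-! ### Plots of `EG` and `BG` -/

variable {G : Type*}

/-- The class `[t, g]` in `EG`. -/
def EG.mk (t : InfSimplex) (g : ℕ → G) : EG G := Quotient.mk (EG.setoid G) (t, g)

theorem EG.exists_rep (x : EG G) : ∃ t g, EG.mk t g = x := by
  induction x using Quotient.ind with
  | _ a => exact ⟨a.1, a.2, rfl⟩

theorem BG.exists_rep [Group G] (b : BG G) : ∃ x, (EG.proj G).toFun x = b := by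
  induction b using Quotient.ind with
  | _ x => exact ⟨x, rfl⟩

theorem BG.exists_coord_eq [Group G] (b : BG G) : ∃ t : InfSimplex, ∀ i, BG.coord i b = t.1 i := by
  obtain ⟨x, rfl⟩ := BG.exists_rep b
  obtain ⟨t, g, rfl⟩ := EG.exists_rep x
  exact ⟨t, fun _ => rfl⟩

theorem EG.isPlot_mk [DiffeologicalSpace G] {n : ℕ} {t : EuclideanSpace ℝ (Fin n) → InfSimplex}
    {g : EuclideanSpace ℝ (Fin n) → ℕ → G} (ht : IsPlot t) (hg : ∀ i, IsPlot fun y => g y i) :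
    IsPlot fun y => EG.mk (t y) (g y) :=
  fun _ => ⟨fun y => (t y, g y), ⟨ht, hg⟩, .of_forall fun _ => rfl⟩

theorem EG.exists_lift [DiffeologicalSpace G] {n : ℕ} {p : EuclideanSpace ℝ (Fin n) → EG G}
    (hp : IsPlot p) (x : EuclideanSpace ℝ (Fin n)) :
    ∃ (t : EuclideanSpace ℝ (Fin n) → InfSimplex) (g : EuclideanSpace ℝ (Fin n) → ℕ → G),
      IsPlot t ∧ (∀ i, IsPlot fun y => g y i) ∧ ∀ᶠ y in 𝓝 x, EG.mk (t y) (g y) = p y := by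
  obtain ⟨q, hq, hx⟩ := hp x
  exact ⟨fun y => (q y).1, fun y => (q y).2, hq.1, hq.2, hx⟩

/-- Plots lift locally through both quotients, `EG → BG` and `Δ^ω × ∏ G → EG`. Smoothness on `BG` is
thereby checked on explicit representatives. -/
theorem BG.exists_lift [Group G] [DiffeologicalSpace G] {n : ℕ}
    {p : EuclideanSpace ℝ (Fin n) → BG G} (hp : IsPlot p) (x : EuclideanSpace ℝ (Fin n)) :
    ∃ (t : EuclideanSpace ℝ (Fin n) → InfSimplex) (g : EuclideanSpace ℝ (Fin n) → ℕ → G),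
      IsPlot t ∧ (∀ i, IsPlot fun y => g y i) ∧
        ∀ᶠ y in 𝓝 x, (EG.proj G).toFun (EG.mk (t y) (g y)) = p y := by
  obtain ⟨q, hq, hx⟩ := hp x
  obtain ⟨t, g, ht, hg, hx'⟩ := EG.exists_lift hq x
  refine ⟨t, g, ht, hg, ?_⟩
  filter_upwards [hx, hx'] with y h1 h2
  rw [h2]
  exact h1

theorem InfSimplex.contDiff_coord {n : ℕ} {t : EuclideanSpace ℝ (Fin n) → InfSimplex}
    (ht : IsPlot t) (i : ℕ) : ContDiff ℝ ∞ fun y => (t y).1 i :=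
  ht.1 i

theorem InfSimplex.eventually_coord_eq_zero {n : ℕ} {t : EuclideanSpace ℝ (Fin n) → InfSimplex}
    (ht : IsPlot t) (x : EuclideanSpace ℝ (Fin n)) :
    ∃ N, ∀ᶠ y in 𝓝 x, ∀ i > N, (t y).1 i = 0 :=
  ht.2 x

theorem BG.eventually_coord_eq_zero [Group G] [DiffeologicalSpace G] {n : ℕ}
    {p : EuclideanSpace ℝ (Fin n) → BG G} (hp : IsPlot p) (x : EuclideanSpace ℝ (Fin n)) :
    ∃ N, ∀ᶠ y in 𝓝 x, ∀ i > N, BG.coord i (p y) = 0 := by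
  obtain ⟨t, g, ht, -, hx⟩ := BG.exists_lift hp x
  obtain ⟨N, hN⟩ := InfSimplex.eventually_coord_eq_zero ht x
  refine ⟨N, ?_⟩
  filter_upwards [hx, hN] with y h1 h2 i hi
  rw [← h1]
  exact h2 i hi

theorem BG.dSmooth_coord [Group G] [DiffeologicalSpace G] (i : ℕ) :
    DSmooth (BG.coord i : BG G → ℝ) := fun n p hp => by
  refine isPlot_of_eventuallyEq fun x => ?_
  obtain ⟨t, g, ht, -, hx⟩ := BG.exists_lift hp x
  refine ⟨fun y => (t y).1 i, (InfSimplex.contDiff_coord ht i).isPlot, ?_⟩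
  filter_upwards [hx] with y h1
  change _ = BG.coord i (p y)
  rw [← h1]
  rfl

theorem EG.dSmooth_proj [Group G] [DiffeologicalSpace G] : DSmooth (EG.proj G).toFun :=
  fun _ p hp _ => ⟨p, hp, .of_forall fun _ => rfl⟩

theorem EG.dSmooth_smul [Group G] [DiffeologicalSpace G] [DiffeologicalGroup G] :
    DSmooth fun z : EG G × G => MulOpposite.op z.2 • z.1 := fun n p hp => by
  refine isPlot_of_eventuallyEq fun x => ?_
  obtain ⟨t, g, ht, hg, hx⟩ := EG.exists_lift hp.1 x
  refine ⟨fun y => EG.mk (t y) fun i => g y i * (p y).2,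
    EG.isPlot_mk ht fun i => (hg i).mul hp.2, ?_⟩
  filter_upwards [hx] with y h1
  change _ = MulOpposite.op (p y).2 • (p y).1
  rw [← h1]
  rfl

/-! ### Local trivialisations -/

theorem BG.coord_ne_zero [Group G] {i : ℕ} {b : BG G} (hb : b ∈ BG.cover G i) :
    BG.coord i b ≠ 0 :=
  ((by positivity : (0 : ℝ) < 1 / 2 ^ (i + 2)).trans hb).ne'

open Classical in
/-- The function `[t, g] ↦ g i` on the part of `EG` where `t i ≠ 0`, extended by `1`. -/
noncomputable def EG.groupCoord [Group G] (i : ℕ) : EG G → G :=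
  Quotient.lift (fun a : InfSimplex × (ℕ → G) => if a.1.1 i = 0 then 1 else a.2 i)
    fun a b h => by
      by_cases h0 : a.1.1 i = 0
      · simp [h0, ← h.1 i]
      · simp [h0, ← h.1 i, h.2 i h0]

theorem EG.groupCoord_mk [Group G] {i : ℕ} {t : InfSimplex} (g : ℕ → G) (h : t.1 i ≠ 0) :
    EG.groupCoord i (EG.mk t g) = g i :=
  if_neg h

theorem EG.groupCoord_smul [Group G] {i : ℕ} {x : EG G} (h : EG.coord i x ≠ 0) (a : G) :
    EG.groupCoord i (MulOpposite.op a • x) = EG.groupCoord i x * a := by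
  obtain ⟨t, g, rfl⟩ := EG.exists_rep x
  rw [EG.groupCoord_mk g h]
  exact EG.groupCoord_mk (fun j => g j * a) h

/-- Each orbit over `B_i` contains exactly one point with a prescribed `i`-th group entry, which
gives bijectivity. Smoothness of the inverse is verified on local lifts. -/
theorem EG.isTrivial_restrict [Group G] [DiffeologicalSpace G] [DiffeologicalGroup G] (i : ℕ) :
    ((EG.proj G).restrict (BG.cover G i)).IsTrivial := by
  let f : (EG.proj G).Preimage (BG.cover G i) → BG.cover G i × G := fun x =>
    (((EG.proj G).restrict (BG.cover G i)).toFun x, EG.groupCoord i x.1)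
  have hne : ∀ x : (EG.proj G).Preimage (BG.cover G i), EG.coord i x.1 ≠ 0 := fun x =>
    BG.coord_ne_zero x.2
  have hequiv : ∀ (x : (EG.proj G).Preimage (BG.cover G i)) (g : G),
      f (MulOpposite.op g • x) = ((f x).1, (f x).2 * g) := fun x g =>
    Prod.ext (((EG.proj G).restrict (BG.cover G i)).invariant x g)
      (EG.groupCoord_smul (hne x) g)
  have hbij : Function.Bijective f := by
    constructor
    · intro x x' h
      have h1 : (EG.proj G).toFun x'.1 = (EG.proj G).toFun x.1 :=
        (congrArg (fun w => (w.1 : BG G)) h).symm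
      have h2 : EG.groupCoord i x.1 = EG.groupCoord i x'.1 := congrArg Prod.snd h
      obtain ⟨g, hg⟩ : x'.1 ∈ MulAction.orbit Gᵐᵒᵖ x.1 := Quotient.exact h1
      have hg' : MulOpposite.op g.unop • x.1 = x'.1 := hg
      -- Equal `i`-th entries along an orbit force the translating element to be `1`.
      rw [← hg', EG.groupCoord_smul (hne x), left_eq_mul] at h2
      rw [h2, MulOpposite.op_one, one_smul] at hg'
      exact Subtype.ext hg'
    · rintro ⟨⟨b, hb⟩, a⟩
      obtain ⟨x, rfl⟩ := BG.exists_rep b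
      let z : (EG.proj G).Preimage (BG.cover G i) := ⟨x, hb⟩
      refine ⟨MulOpposite.op ((EG.groupCoord i x)⁻¹ * a) • z, ?_⟩
      rw [hequiv]
      exact Prod.ext rfl (mul_inv_cancel_left _ _)
  refine ⟨Equiv.ofBijective f hbij, ?_, ?_, fun _ => rfl, hequiv⟩
  · intro n p hp
    refine ⟨EG.dSmooth_proj n _ hp, isPlot_of_eventuallyEq fun x => ?_⟩
    obtain ⟨t, g, ht, hg, hx⟩ := EG.exists_lift hp x
    -- `EG.groupCoord` jumps to the default `1` where `t i = 0`, but this plot stays over `B_i`, so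
    -- near `x` it agrees with the smooth entry `g i` of a lift.
    refine ⟨fun y => g y i, hg i, ?_⟩
    filter_upwards [hx] with y hy
    have h0 := hne (p y)
    change _ = EG.groupCoord i (p y).1
    rw [← hy] at h0 ⊢
    exact (EG.groupCoord_mk (g y) h0).symm
  · intro n p hp
    refine isPlot_of_eventuallyEq (X := EG G)
      (p := fun y => ((Equiv.ofBijective f hbij).symm (p y)).1) fun x => ?_
    obtain ⟨t, g, ht, hg, hx⟩ := BG.exists_lift hp.1 x
    -- Translating the lift by `(g i)⁻¹ * a` turns its `i`-th entry into `a`; the result is smooth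
    -- because `G` is a diffeological group.
    refine ⟨fun y => EG.mk (t y) fun j => g y j * ((g y i)⁻¹ * (p y).2),
      EG.isPlot_mk ht fun j => (hg j).mul ((hg i).inv.mul hp.2), ?_⟩
    filter_upwards [hx] with y hy
    have hmem : (EG.proj G).toFun (EG.mk (t y) (g y)) ∈ BG.cover G i := hy ▸ (p y).1.2
    let z : (EG.proj G).Preimage (BG.cover G i) := ⟨EG.mk (t y) (g y), hmem⟩
    have hz : Equiv.ofBijective f hbij (MulOpposite.op ((g y i)⁻¹ * (p y).2) • z) = p y := by
      change f _ = _
      rw [hequiv]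
      refine Prod.ext (Subtype.ext hy) ?_
      change EG.groupCoord i (EG.mk (t y) (g y)) * _ = _
      rw [EG.groupCoord_mk (g y) (hne z), mul_inv_cancel_left]
    exact congrArg Subtype.val ((Equiv.symm_apply_eq _).2 hz.symm).symm

/-! ### The cover and the partition of unity -/

theorem sum_range_one_div_two_pow (N : ℕ) :
    ∑ i ∈ Finset.range N, (1 : ℝ) / 2 ^ (i + 1) = 1 - 1 / 2 ^ N := by
  induction N with
  | zero => simp
  | succ N ih =>
    rw [Finset.sum_range_succ, ih, pow_succ]
    field_simp
    ring

/-- Otherwise, with the support in `range N`, the total mass would be at most `1 - 1 / 2 ^ N < 1`.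
Finite support is what makes the inequality strict. -/
theorem InfSimplex.exists_lt (t : InfSimplex) : ∃ i, 1 / 2 ^ (i + 1) < t.1 i := by
  by_contra! h
  obtain ⟨N, hN⟩ := t.1.support.exists_nat_subset_range
  have h1 : ∑ i ∈ Finset.range N, t.1 i = 1 :=
    (Finsupp.sum_of_support_subset _ hN _ fun _ _ => rfl).symm.trans t.2.1
  have h2 := Finset.sum_le_sum fun i (_ : i ∈ Finset.range N) => h i
  rw [h1, sum_range_one_div_two_pow] at h2
  have h3 : (0 : ℝ) < 1 / 2 ^ N := by positivity
  linarith

theorem BG.exists_lt_coord [Group G] (b : BG G) : ∃ i, 1 / 2 ^ (i + 1) < BG.coord i b := by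
  obtain ⟨t, ht⟩ := BG.exists_coord_eq b
  obtain ⟨i, hi⟩ := t.exists_lt
  exact ⟨i, (ht i).symm ▸ hi⟩

theorem one_div_two_pow_succ_lt (i : ℕ) : (1 : ℝ) / 2 ^ (i + 2) < 1 / 2 ^ (i + 1) :=
  one_div_lt_one_div_of_lt (by positivity) (pow_lt_pow_right₀ one_lt_two (Nat.lt_succ_self _))

theorem BG.isDOpenCover_cover [Group G] [DiffeologicalSpace G] : IsDOpenCover (BG.cover G) := by
  refine ⟨fun i => (BG.dSmooth_coord i).isOpen_preimage_real isOpen_Ioi,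
    eq_univ_of_forall fun b => ?_⟩
  obtain ⟨i, hi⟩ := BG.exists_lt_coord b
  exact mem_iUnion.2 ⟨i, (one_div_two_pow_succ_lt i).trans hi⟩

/-- If the coordinates of `b` vanish beyond `N`, the points whose coordinates beyond `N` lie below
the thresholds form a neighbourhood missing every `B_i` with `i > N`. It is cut out by infinitely
many conditions, but along a plot only finitely many matter near a point. -/
theorem BG.dLocallyFinite_cover [Group G] [DiffeologicalSpace G] :
    DLocallyFinite (BG.cover G) := fun b => by
  -- A point is a constant plot on `ℝ⁰`, so the local bound for plots bounds its support.
  obtain ⟨N, hN⟩ := BG.eventually_coord_eq_zero (isPlot_const (n := 0) (x := b)) 0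
  have hb := hN.self_of_nhds
  refine ⟨{c | ∀ i > N, BG.coord i c < 1 / 2 ^ (i + 2)}, ?_, fun i hi => ?_,
    (finite_Iic N).subset ?_⟩
  · refine isOpen_iff_preimages_plots.2 fun n p hp => isOpen_iff_mem_nhds.2 fun x hx => ?_
    obtain ⟨M, hM⟩ := BG.eventually_coord_eq_zero hp x
    have hfin : ∀ᶠ y in 𝓝 x, ∀ i ∈ Finset.Ioc N M, BG.coord i (p y) < 1 / 2 ^ (i + 2) := by
      refine (Finset.eventually_all _).2 fun i hi => ?_
      exact ((BG.dSmooth_coord i n p hp).contDiff.continuous.continuousAt).eventually_lt_const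
        (hx i (Finset.mem_Ioc.1 hi).1)
    filter_upwards [hM, hfin] with y h1 h2 i hi
    rcases le_or_gt i M with h | h
    · exact h2 i (Finset.mem_Ioc.2 ⟨hi, h⟩)
    · rw [h1 i h]
      positivity
  · rw [hb i hi]
    positivity
  · rintro i ⟨c, hc, hc'⟩
    by_contra hi
    exact lt_asymm hc (hc' i (not_le.1 hi))

/-! ### Normalised cutoff functions -/

section PartitionOfUnity

variable [Group G] {ρ : ℝ → ℝ}

/-- Monotonicity is assumed only on the open half-line, so the comparison with `ρ 0 = 0` passes
through the right-hand limit at `0`; the midpoint `t / 2` then gives strictness. -/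
theorem pos_of_strictMonoOn_Ioi (hc : Continuous ρ) (h0 : ∀ t ≤ 0, ρ t = 0)
    (hρ : StrictMonoOn ρ (Ioi 0)) {t : ℝ} (ht : 0 < t) : 0 < ρ t := by
  have h1 : 0 ≤ ρ (t / 2) := by
    rw [← h0 0 le_rfl]
    refine le_of_tendsto (hc.continuousWithinAt (s := Ioi 0) (x := 0)) ?_
    filter_upwards [Ioo_mem_nhdsGT (half_pos ht)] with s hs
    exact (hρ hs.1 (half_pos ht) hs.2).le
  exact h1.trans_lt (hρ (half_pos ht) ht (half_lt_self ht))

theorem nonneg_of_strictMonoOn_Ioi (hc : Continuous ρ) (h0 : ∀ t ≤ 0, ρ t = 0)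
    (hρ : StrictMonoOn ρ (Ioi 0)) (t : ℝ) : 0 ≤ ρ t := by
  rcases le_or_gt t 0 with h | h
  · exact (h0 t h).ge
  · exact (pos_of_strictMonoOn_Ioi hc h0 hρ h).le

theorem BG.eq_zero_of_coord_eq_zero (h0 : ∀ t ≤ 0, ρ t = 0) {b : BG G} {i : ℕ}
    (h : BG.coord i b = 0) : ρ (BG.coord i b - 1 / 2 ^ (i + 1)) = 0 := by
  refine h0 _ ?_
  rw [h, zero_sub, neg_nonpos]
  positivity

theorem BG.support_finite (h0 : ∀ t ≤ 0, ρ t = 0) (b : BG G) :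
    (Function.support fun j => ρ (BG.coord j b - 1 / 2 ^ (j + 1))).Finite := by
  obtain ⟨t, ht⟩ := BG.exists_coord_eq b
  refine t.1.support.finite_toSet.subset fun j hj => Finsupp.mem_support_iff.2 fun h => hj ?_
  exact BG.eq_zero_of_coord_eq_zero h0 ((ht j).trans h)

theorem BG.finsum_pos (hc : Continuous ρ) (h0 : ∀ t ≤ 0, ρ t = 0)
    (hρ : StrictMonoOn ρ (Ioi 0)) (b : BG G) :
    0 < ∑ᶠ j : ℕ, ρ (BG.coord j b - 1 / 2 ^ (j + 1)) := by
  obtain ⟨i, hi⟩ := BG.exists_lt_coord b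
  exact _root_.finsum_pos (fun _ => nonneg_of_strictMonoOn_Ioi hc h0 hρ _)
    ⟨i, pos_of_strictMonoOn_Ioi hc h0 hρ (sub_pos.2 hi)⟩ (BG.support_finite h0 b)

variable [DiffeologicalSpace G]

theorem BG.dSmooth_tau (hs : ContDiff ℝ ∞ ρ) (h0 : ∀ t ≤ 0, ρ t = 0)
    (hρ : StrictMonoOn ρ (Ioi 0)) (i : ℕ) : DSmooth (BG.tau G ρ i) := fun n p hp => by
  have hterm : ∀ j, ContDiff ℝ ∞ fun y => ρ (BG.coord j (p y) - 1 / 2 ^ (j + 1)) := fun j =>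
    hs.comp ((BG.dSmooth_coord j n p hp).contDiff.sub contDiff_const)
  have hsum : ContDiff ℝ ∞ fun y => ∑ᶠ j : ℕ, ρ (BG.coord j (p y) - 1 / 2 ^ (j + 1)) := by
    refine contDiff_iff_contDiffAt.2 fun x => ?_
    obtain ⟨N, hN⟩ := BG.eventually_coord_eq_zero hp x
    -- Near `x` only the indices `j ≤ N` contribute, so the sum is locally a fixed finite sum of
    -- smooth functions.
    refine (ContDiff.sum (s := Finset.range (N + 1))
      fun j _ => hterm j).contDiffAt.congr_of_eventuallyEq ?_
    filter_upwards [hN] with y hy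
    refine finsum_eq_sum_of_support_subset _ fun j hj => ?_
    rw [Finset.coe_range, mem_Iio, Nat.lt_succ_iff]
    by_contra h
    exact hj (BG.eq_zero_of_coord_eq_zero h0 (hy j (not_le.1 h)))
  exact ((hterm i).div hsum fun y => (BG.finsum_pos hs.continuous h0 hρ (p y)).ne').isPlot

/-- Positivity of `τ_i` forces `t i ≥ 1 / 2 ^ (i + 1)`. This condition is D-closed, so it persists
on the support and places it in `B_i`. -/
theorem BG.isSubordinate_tau (h0 : ∀ t ≤ 0, ρ t = 0) :
    IsSubordinate (BG.tau G ρ) (BG.cover G) := fun i => by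
  have hsub : BG.tau G ρ i ⁻¹' Ioi 0 ⊆ BG.coord i ⁻¹' Ici (1 / 2 ^ (i + 1)) := fun b hb => by
    by_contra h
    refine lt_irrefl (0 : ℝ) (lt_of_lt_of_eq hb ?_)
    change _ / _ = _
    rw [h0 _ (sub_nonpos.2 (not_le.1 h).le), zero_div]
  have hcl := (BG.dSmooth_coord (G := G) i).isClosed_preimage_Ici (1 / 2 ^ (i + 1))
  exact fun b hb => (one_div_two_pow_succ_lt i).trans_le
    (@closure_minimal _ dTopology _ _ hsub hcl b hb)

theorem BG.isSmoothPartitionOfUnity_tau (hs : ContDiff ℝ ∞ ρ) (h0 : ∀ t ≤ 0, ρ t = 0)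
    (hρ : StrictMonoOn ρ (Ioi 0)) : IsSmoothPartitionOfUnity (BG.tau G ρ) where
  smooth := BG.dSmooth_tau hs h0 hρ
  nonneg _ b := div_nonneg (nonneg_of_strictMonoOn_Ioi hs.continuous h0 hρ _)
    (BG.finsum_pos hs.continuous h0 hρ b).le
  locallyFinite := BG.dLocallyFinite_cover.mono (BG.isSubordinate_tau h0)
  sum_eq_one b := by
    simp only [BG.tau, div_eq_mul_inv _ (finsum _)]
    rw [← finsum_mul' _ _ (BG.support_finite h0 b)]
    exact mul_inv_cancel₀ (BG.finsum_pos hs.continuous h0 hρ b).ne'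

end PartitionOfUnity

/-! ### Principality and numerability -/

theorem strictMonoOn_expNegInvGlue : StrictMonoOn expNegInvGlue (Ioi 0) := fun x hx y hy h => by
  rw [expNegInvGlue, expNegInvGlue, if_neg (not_le.2 hx), if_neg (not_le.2 hy)]
  exact Real.exp_lt_exp.2 (neg_lt_neg (inv_strictAnti₀ hx h))

theorem EG.isPrincipalBundle_proj [Group G] [DiffeologicalSpace G] [DiffeologicalGroup G] :
    (EG.proj G).IsPrincipalBundle where
  smooth := EG.dSmooth_proj
  smooth_action := EG.dSmooth_smul
  locallyTrivial_pullback _ _ _ p hp := by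
    refine ⟨range fun i => p ⁻¹' BG.cover G i, ?_, ?_, ?_⟩
    · rintro _ ⟨i, rfl⟩
      exact hp.isOpen_preimage (BG.isDOpenCover_cover.1 i)
    · rw [sUnion_range, ← preimage_iUnion, BG.isDOpenCover_cover.2, preimage_univ]
    · rintro _ ⟨i, rfl⟩
      exact (EG.isTrivial_restrict i).pullback_restrict hp

end Diffeology

theorem mainTheorem4 {G : Type*} [Group G] [DiffeologicalSpace G]
    [Diffeology.DiffeologicalGroup G] :
    (Diffeology.EG.proj G).IsPrincipalBundle ∧
    (Diffeology.EG.proj G).IsDNumerable ∧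
    Diffeology.IsDOpenCover (Diffeology.BG.cover G) ∧
    Diffeology.DLocallyFinite (Diffeology.BG.cover G) ∧
    (∀ i : ℕ, ((Diffeology.EG.proj G).restrict (Diffeology.BG.cover G i)).IsTrivial) ∧
    (∀ ρ : ℝ → ℝ, ContDiff ℝ ∞ ρ → (∀ t ≤ 0, ρ t = 0) → StrictMonoOn ρ (Ioi 0) →
      Diffeology.IsSmoothPartitionOfUnity (Diffeology.BG.tau G ρ) ∧
      Diffeology.IsSubordinate (Diffeology.BG.tau G ρ) (Diffeology.BG.cover G)) := by
  -- Numerability needs a single admissible `ρ`; the choice is `exp (-1 / t)` for `t > 0`, extended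
  -- by `0`.
  have h0 : ∀ t ≤ 0, expNegInvGlue t = 0 := fun _ ht => expNegInvGlue.zero_of_nonpos ht
  exact ⟨Diffeology.EG.isPrincipalBundle_proj,
    ⟨Diffeology.EG.isPrincipalBundle_proj, ℕ, Diffeology.BG.cover G,
      Diffeology.BG.tau G expNegInvGlue, Diffeology.BG.isDOpenCover_cover,
      Diffeology.BG.isSmoothPartitionOfUnity_tau expNegInvGlue.contDiff h0
        Diffeology.strictMonoOn_expNegInvGlue,
      Diffeology.BG.isSubordinate_tau h0, Diffeology.EG.isTrivial_restrict⟩,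
    Diffeology.BG.isDOpenCover_cover, Diffeology.BG.dLocallyFinite_cover,
    Diffeology.EG.isTrivial_restrict, fun _ hs h0 hρ =>
      ⟨Diffeology.BG.isSmoothPartitionOfUnity_tau hs h0 hρ, Diffeology.BG.isSubordinate_tau h0⟩⟩
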